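/- All matroids and lattices are finite. For a matroid $M$, a flat $X$ of $M$ is cyclic if the restriction $M|X$ has no isthmuses (coloops); ordered by inclusion, the cyclic flats of $M$ form a lattice, denoted $\mathcal{Z}(M)$. A lattice $L$ is a Tr-lattice if every matroid $N$ for which $\mathcal{Z}(N)$ is isomorphic to $L$ is transversal, that is, there is a finite family $(A_j)_{j\in J}$ of subsets of the ground set of $N$ whose partial transversals are exactly the independent sets of $N$. A matroid is nested if its cyclic flats form a chain under inclusion, and it is connected if every two distinct elements of its ground set lie in a common circuit. Let $M$ be a matroid such that $\mathcal{Z}(M)$ is a Tr-lattice. Then the matroid obtained from $M$ by deleting all loops and isthmuses is either connected or a direct sum of at most two nested matroids (the two alternatives need not exclude each other). -/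

import Mathlib

open Set Function

universe u

namespace Matroid

variable {α : Type u}

/-- A flat `X` of `M` is cyclic if the restriction `M|X` has no isthmuses (coloops). -/
structure IsCyclicFlat (M : Matroid α) (X : Set α) : Prop where
  isFlat : M.IsFlat X
  coloops_eq_empty : (M.restrict X).coloops = ∅

/-- Closure form of the absence of isthmuses. -/
theorem isCyclicFlat_iff (M : Matroid α) (X : Set α) :
    M.IsCyclicFlat X ↔ M.IsFlat X ∧ ∀ e ∈ X, e ∈ M.closure (X \ {e}) := by
  refine ⟨fun h => ⟨h.isFlat, fun e he => ?_⟩, fun h => ⟨h.1, ?_⟩⟩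
  · by_contra hcl
    have : e ∈ (M.restrict X).coloops :=
      (restrict_isColoop_iff h.isFlat.subset_ground).2 ⟨hcl, he⟩
    rw [h.coloops_eq_empty] at this
    exact this
  · refine Set.eq_empty_iff_forall_notMem.2 fun e he => ?_
    have := (restrict_isColoop_iff h.1.subset_ground).1 he
    exact this.1 (h.2 e this.2)

/-- The closure of the union of two cyclic flats is a cyclic flat. -/
theorem IsCyclicFlat.closure_union {M : Matroid α} {X Y : Set α} (hX : M.IsCyclicFlat X)
    (hY : M.IsCyclicFlat Y) : M.IsCyclicFlat (M.closure (X ∪ Y)) := by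
  rw [isCyclicFlat_iff] at hX hY ⊢
  have hE : X ∪ Y ⊆ M.E := union_subset hX.1.subset_ground hY.1.subset_ground
  have hsub := M.subset_closure (X ∪ Y) hE
  refine ⟨M.isFlat_closure _, fun e he => ?_⟩
  by_cases heX : e ∈ X
  · exact M.closure_subset_closure
      (sdiff_subset_sdiff_left (subset_union_left.trans hsub)) (hX.2 e heX)
  by_cases heY : e ∈ Y
  · exact M.closure_subset_closure
      (sdiff_subset_sdiff_left (subset_union_right.trans hsub)) (hY.2 e heY)
  · have hsub' : X ∪ Y ⊆ M.closure (X ∪ Y) \ {e} := by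
      intro x hx
      refine ⟨hsub hx, ?_⟩
      rintro rfl
      exact hx.elim heX heY
    exact M.closure_subset_closure hsub' he

/-- The union of the circuits contained in the intersection of two cyclic flats is a cyclic flat. -/
theorem IsCyclicFlat.sUnion_circuits {M : Matroid α} {X Y : Set α} (hX : M.IsCyclicFlat X)
    (hY : M.IsCyclicFlat Y) : M.IsCyclicFlat (⋃₀ {C | M.IsCircuit C ∧ C ⊆ X ∩ Y}) := by
  rw [isCyclicFlat_iff] at hX hY ⊢
  set U := ⋃₀ {C | M.IsCircuit C ∧ C ⊆ X ∩ Y} with hU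
  have hUE : U ⊆ M.E := sUnion_subset fun C hC => hC.1.subset_ground
  have hUX : U ⊆ X := sUnion_subset fun C hC => hC.2.trans inter_subset_left
  have hUY : U ⊆ Y := sUnion_subset fun C hC => hC.2.trans inter_subset_right
  have hcl : M.closure U ⊆ U := by
    intro e he
    by_contra heU
    obtain ⟨C, hCU, hC, heC⟩ := (mem_closure_iff_exists_isCircuit heU).1 he
    have heX : e ∈ X := hX.1.closure ▸ M.closure_subset_closure hUX he
    have heY : e ∈ Y := hY.1.closure ▸ M.closure_subset_closure hUY he
    exact heU ⟨C, ⟨hC, fun x hx => (hCU hx).elim (fun h => h ▸ ⟨heX, heY⟩)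
      fun h => ⟨hUX h, hUY h⟩⟩, heC⟩
  refine ⟨?_, ?_⟩
  · rw [← hcl.antisymm (M.subset_closure U hUE)]
    exact M.isFlat_closure _
  · rintro e ⟨C, hC, heC⟩
    exact M.closure_subset_closure (sdiff_subset_sdiff_left (subset_sUnion_of_mem hC))
      (hC.1.mem_closure_sdiff_singleton_of_mem heC)

/-- The collection `Z(M)` of cyclic flats of `M`, ordered by inclusion. -/
def CyclicFlats (M : Matroid α) : Type u := {X : Set α // M.IsCyclicFlat X}

/-- `Z(M)` is a lattice: the join of `X` and `Y` is the closure of `X ∪ Y`, and their meet is the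
union of the circuits contained in `X ∩ Y`. -/
instance CyclicFlats.instLattice (M : Matroid α) : Lattice M.CyclicFlats where
  le X Y := X.1 ⊆ Y.1
  le_refl _ := Subset.rfl
  le_trans _ _ _ := Subset.trans
  le_antisymm _ _ h h' := Subtype.ext (h.antisymm h')
  sup X Y := ⟨M.closure (X.1 ∪ Y.1), X.2.closure_union Y.2⟩
  inf X Y := ⟨⋃₀ {C | M.IsCircuit C ∧ C ⊆ X.1 ∩ Y.1}, X.2.sUnion_circuits Y.2⟩
  le_sup_left X Y := subset_union_left.trans (M.subset_closure (X.1 ∪ Y.1)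
    (union_subset X.2.isFlat.subset_ground Y.2.isFlat.subset_ground))
  le_sup_right X Y := subset_union_right.trans (M.subset_closure (X.1 ∪ Y.1)
    (union_subset X.2.isFlat.subset_ground Y.2.isFlat.subset_ground))
  sup_le X Y Z hX hY := by
    change M.closure (X.1 ∪ Y.1) ⊆ Z.1
    rw [← Z.2.isFlat.closure]
    exact M.closure_subset_closure (union_subset hX hY)
  inf_le_left X Y := sUnion_subset fun C hC => hC.2.trans inter_subset_left
  inf_le_right X Y := sUnion_subset fun C hC => hC.2.trans inter_subset_right
  le_inf X Y Z hY hZ := by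
    intro e he
    have hcl := ((isCyclicFlat_iff M X.1).1 X.2).2 e he
    obtain ⟨C, hCX, hC, heC⟩ :=
      (mem_closure_iff_exists_isCircuit (fun h => h.2 rfl)).1 hcl
    refine ⟨C, ⟨hC, hCX.trans ?_⟩, heC⟩
    exact insert_subset ⟨hY he, hZ he⟩ fun x hx => ⟨hY hx.1, hZ hx.1⟩

/-- `M` is transversal if there is a finite family `A 0, …, A (n - 1)` of subsets of the ground set
whose partial transversals are exactly the independent sets of `M`. -/
def IsTransversal (M : Matroid α) : Prop :=
  ∃ (n : ℕ) (A : Fin n → Set α), (∀ j, A j ⊆ M.E) ∧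
    ∀ I : Set α, M.Indep I ↔ ∃ f : I → Fin n, Injective f ∧ ∀ e : I, (e : α) ∈ A (f e)

/-- `M` is nested if its cyclic flats form a chain under inclusion. -/
def IsNested (M : Matroid α) : Prop := ∀ X Y : M.CyclicFlats, X ≤ Y ∨ Y ≤ X

/-- `M` is connected if any two distinct elements of its ground set lie in a common circuit. -/
def IsConnected (M : Matroid α) : Prop :=
  ∀ e ∈ M.E, ∀ f ∈ M.E, e ≠ f → ∃ C, M.IsCircuit C ∧ e ∈ C ∧ f ∈ C

end Matroid

/-- A finite lattice `L` is a Tr-lattice if every (finite) matroid whose lattice of cyclic flats is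
isomorphic to `L` is transversal. -/
def IsTrLattice (L : Type u) [Lattice L] : Prop :=
  Finite L ∧ ∀ (β : Type u) (N : Matroid β), N.Finite →
    Nonempty (N.CyclicFlats ≃o L) → N.IsTransversal

/-! The key fact is `IsTrLattice.le_sup_of_three`: among any three elements of a Tr-lattice, one
lies below the join of the other two. In a transversal matroid a coloop-free set has rank equal to
the number of presentation sets meeting it, so inclusion–exclusion gives a Mason–Ingleton inequality
for three such sets (`IsTransversal.eRk_union_le`). Conversely, every strictly increasing submodular
`r` on `L` with `r ⊥ = 0` gives the ranks of the cyclic flats of a matroid whose lattice is `L`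
(`LatticeMatroid.orderIso`). If the three-element condition fails, `r` can be chosen to violate the
inequality.

If, after deletion of loops and coloops, the matroid is disconnected, it splits along a separator
`A`. Take cyclic flats `X`, `Y` of the part on `A` and a circuit `D` in the other part. Neither side
of a separator helps to span the other, so the condition for `X`, `Y`, `D` forces `X` and `Y` to be
comparable. Hence both parts are nested. -/

theorem Finset.exists_injective_of_forall_subset_card_le {ι α : Type*} [DecidableEq ι]
    [DecidableEq α] (t : ι → Finset α) (S : Finset ι)
    (h : ∀ s ⊆ S, s.card ≤ (s.biUnion t).card) :
    ∃ g : S → α, Injective g ∧ ∀ j : S, g j ∈ t j := by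
  refine (Finset.all_card_le_biUnion_card_iff_exists_injective fun j : S => t j).1 fun s => ?_
  have h' := h (s.image Subtype.val) fun x hx => by
    obtain ⟨y, -, rfl⟩ := Finset.mem_image.1 hx
    exact y.2
  rwa [Finset.card_image_of_injective s Subtype.coe_injective, Finset.image_biUnion] at h'

/-! ### Ranks of coloop-free sets in transversal matroids. -/

namespace Matroid

variable {α : Type u} {M : Matroid α}

/-- Hall's condition for the sets of a presentation that meet a coloop-free set. -/
theorem card_le_card_biUnion_of_presentation {n : ℕ} {A : Fin n → Set α} [DecidableEq α]
    (hM : ∀ I : Set α, M.Indep I ↔ ∃ f : I → Fin n, Injective f ∧ ∀ e : I, (e : α) ∈ A (f e))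
    {X : Set α} (hX : ∀ e ∈ X, e ∈ M.closure (X \ {e})) {t : Fin n → Finset α}
    (ht : ∀ j, (t j : Set α) = A j ∩ X) (s : Finset (Fin n)) (hs : ∀ j ∈ s, (t j).Nonempty) :
    s.card ≤ (s.biUnion t).card := by
  induction s using Finset.strongInduction with
  | H s ih =>
  -- In a minimal violating `s`, all indices but `k` can be matched, and they use up every element
  -- of the union.
  by_contra! hlt
  obtain ⟨k, hk⟩ : s.Nonempty := Finset.card_pos.1 (by omega)
  obtain ⟨g, hg, hgt⟩ := Finset.exists_injective_of_forall_subset_card_le t (s.erase k)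
    fun u hu => ih u (hu.trans_ssubset (Finset.erase_ssubset hk)) fun j hj =>
      hs j (Finset.mem_of_mem_erase (hu hj))
  have himg : Finset.univ.image g = s.biUnion t := by
    refine Finset.eq_of_subset_of_card_le ?_ ?_
    · intro x hx
      obtain ⟨j, -, rfl⟩ := Finset.mem_image.1 hx
      exact Finset.mem_biUnion.2 ⟨j, Finset.mem_of_mem_erase j.2, hgt j⟩
    · rw [Finset.card_image_of_injective _ hg, Finset.card_univ, Fintype.card_coe,
        Finset.card_erase_of_mem hk]
      omega
  have hinv : ∀ y ∈ s.biUnion t, ∃ j, g j = y := fun y hy => by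
    rw [← himg] at hy
    simpa using hy
  obtain ⟨e, he⟩ := hs k hk
  have heY : e ∈ s.biUnion t := Finset.mem_biUnion.2 ⟨k, hk, he⟩
  have : Nonempty (s.erase k : Finset (Fin n)) := ⟨(hinv e heY).choose⟩
  choose! w hw using hinv
  have heX : e ∈ X := by
    have : e ∈ (t k : Set α) := he
    rw [ht] at this
    exact this.2
  obtain ⟨C, hCX, hC, heC⟩ := (mem_closure_iff_exists_isCircuit (fun h => h.2 rfl)).1 (hX e heX)
  obtain ⟨f, hf, hfA⟩ := (hM _).1 (hC.sdiff_singleton_indep heC)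
  have hmem : ∀ c ∈ C, c ∉ s.biUnion t → c ∈ C \ {e} := fun c hc hcY =>
    ⟨hc, fun h => hcY (by rw [mem_singleton_iff.1 h]; exact heY)⟩
  have hfs : ∀ c (hc : c ∈ C) (hcY : c ∉ s.biUnion t), f ⟨c, hmem c hc hcY⟩ ∉ s := by
    intro c hc hcY hcs
    refine hcY (Finset.mem_biUnion.2 ⟨_, hcs, ?_⟩)
    have hcX : c ∈ X := (hCX hc).elim (fun h => h ▸ heX) fun h => h.1
    have : c ∈ (t (f ⟨c, hmem c hc hcY⟩) : Set α) := by
      rw [ht]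
      exact ⟨hfA ⟨c, hmem c hc hcY⟩, hcX⟩
    exact this
  -- Elements of `C` in the union take indices in `s.erase k` by inverting `g`; the others keep
  -- their index under `f`, which is outside `s`. So the circuit `C` becomes a partial transversal.
  refine hC.not_indep ((hM C).2 ⟨fun c => if h : (c : α) ∈ s.biUnion t then (w c : Fin n)
    else f ⟨c, hmem c c.2 h⟩, ?_, ?_⟩)
  · rintro ⟨c, hc⟩ ⟨d, hd⟩ hcd
    by_cases hcY : c ∈ s.biUnion t <;> by_cases hdY : d ∈ s.biUnion t
    · simp only [hcY, hdY, dite_true] at hcd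
      rw [Subtype.mk.injEq, ← hw c hcY, ← hw d hdY, Subtype.ext hcd]
    · simp only [hcY, hdY, dite_true, dite_false] at hcd
      exact absurd (hcd ▸ Finset.mem_of_mem_erase (w c).2) (hfs d hd hdY)
    · simp only [hcY, hdY, dite_true, dite_false] at hcd
      exact absurd (hcd ▸ Finset.mem_of_mem_erase (w d).2) (hfs c hc hcY)
    · simp only [hcY, hdY, dite_false] at hcd
      have := hf hcd
      simpa using this
  · rintro ⟨c, hc⟩
    by_cases hcY : c ∈ s.biUnion t
    · simp only [hcY, dite_true]
      have h1 : c ∈ (t (w c) : Set α) := by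
        have := hgt (w c)
        rwa [hw c hcY] at this
      rw [ht] at h1
      exact h1.1
    · simp only [hcY, dite_false]
      exact hfA ⟨c, hmem c hc hcY⟩

/-- The rank of a coloop-free set in a transversal matroid is the number of sets of the presentation
that meet it. -/
theorem eRk_eq_encard_of_presentation [M.Finite] {n : ℕ} {A : Fin n → Set α}
    (hAE : ∀ j, A j ⊆ M.E)
    (hM : ∀ I : Set α, M.Indep I ↔ ∃ f : I → Fin n, Injective f ∧ ∀ e : I, (e : α) ∈ A (f e))
    {X : Set α} (hX : ∀ e ∈ X, e ∈ M.closure (X \ {e})) :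
    M.eRk X = {j | (A j ∩ X).Nonempty}.encard := by
  classical
  refine le_antisymm (M.eRk_le_iff.2 fun I hIX hI => ?_) ?_
  · obtain ⟨f, hf, hfA⟩ := (hM I).1 hI
    exact Function.Embedding.encard_le
      ⟨fun e : I => (⟨f e, e, hfA e, hIX e.2⟩ : {j | (A j ∩ X).Nonempty}), fun a b hab =>
        hf (congrArg Subtype.val hab)⟩
  · have hfin : ∀ j, (A j ∩ X).Finite := fun j =>
      (M.ground_finite.subset (hAE j)).subset inter_subset_left
    set S : Finset (Fin n) := Finset.univ.filter fun j => (A j ∩ X).Nonempty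
    obtain ⟨g, hg, hgt⟩ := Finset.exists_injective_of_forall_subset_card_le
      (fun j => (hfin j).toFinset) S fun s hs =>
        card_le_card_biUnion_of_presentation hM hX (fun j => (hfin j).coe_toFinset) s
          fun j hj => (hfin j).toFinset_nonempty.2 (Finset.mem_filter.1 (hs hj)).2
    have hgt' : ∀ j : S, g j ∈ A j ∩ X := fun j => (hfin j).mem_toFinset.1 (hgt j)
    have hind : M.Indep (range g) := by
      refine (hM _).2 ⟨fun e => (e.2.choose : Fin n), fun a b hab => ?_, fun e => ?_⟩
      · have := Subtype.ext (a1 := a.2.choose) (a2 := b.2.choose) hab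
        rw [Subtype.ext_iff, ← a.2.choose_spec, ← b.2.choose_spec, this]
      · have := (hgt' e.2.choose).1
        rwa [e.2.choose_spec] at this
    refine le_trans ?_ (hind.encard_le_eRk_of_subset (range_subset_iff.2 fun j => (hgt' j).2))
    exact Function.Embedding.encard_le
      ⟨fun j : {j | (A j ∩ X).Nonempty} => (⟨g ⟨j, Finset.mem_filter.2 ⟨Finset.mem_univ _, j.2⟩⟩,
        mem_range_self _⟩ : range g),
        fun a b hab => by simpa [Subtype.ext_iff] using hg (congrArg Subtype.val hab)⟩

theorem mem_closure_union_sdiff {X Y : Set α} (hX : ∀ e ∈ X, e ∈ M.closure (X \ {e}))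
    (hY : ∀ e ∈ Y, e ∈ M.closure (Y \ {e})) :
    ∀ e ∈ X ∪ Y, e ∈ M.closure ((X ∪ Y) \ {e}) := by
  rintro e (he | he)
  · exact M.closure_subset_closure (sdiff_subset_sdiff_left subset_union_left) (hX e he)
  · exact M.closure_subset_closure (sdiff_subset_sdiff_left subset_union_right) (hY e he)

/-- The Mason–Ingleton inequality for three coloop-free sets, without the intersection term. -/
theorem IsTransversal.eRk_union_le [M.Finite] (hM : M.IsTransversal) {X Y Z : Set α}
    (hX : ∀ e ∈ X, e ∈ M.closure (X \ {e})) (hY : ∀ e ∈ Y, e ∈ M.closure (Y \ {e}))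
    (hZ : ∀ e ∈ Z, e ∈ M.closure (Z \ {e})) :
    M.eRk (X ∪ Y) + M.eRk (X ∪ Z) + M.eRk (Y ∪ Z) ≤
      M.eRk X + M.eRk Y + M.eRk Z + M.eRk (X ∪ Y ∪ Z) := by
  classical
  obtain ⟨n, A, hAE, hI⟩ := hM
  have hXY := mem_closure_union_sdiff hX hY
  have key : ∀ {W : Set α}, (∀ e ∈ W, e ∈ M.closure (W \ {e})) →
      M.eRk W = ((Finset.univ.filter fun j => (A j ∩ W).Nonempty).card : ℕ∞) := by
    intro W hW
    rw [eRk_eq_encard_of_presentation hAE hI hW, ← Set.encard_coe_eq_coe_finsetCard]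
    simp
  have hun : ∀ U W : Set α, (Finset.univ.filter fun j => (A j ∩ (U ∪ W)).Nonempty) =
      (Finset.univ.filter fun j => (A j ∩ U).Nonempty) ∪
        (Finset.univ.filter fun j => (A j ∩ W).Nonempty) := by
    intro U W
    ext j
    simp [inter_union_distrib_left, union_nonempty]
  rw [key hX, key hY, key hZ, key hXY, key (mem_closure_union_sdiff hX hZ),
    key (mem_closure_union_sdiff hY hZ), key (mem_closure_union_sdiff hXY hZ)]
  simp only [hun]
  generalize (Finset.univ.filter fun j => (A j ∩ X).Nonempty) = P
  generalize (Finset.univ.filter fun j => (A j ∩ Y).Nonempty) = Q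
  generalize (Finset.univ.filter fun j => (A j ∩ Z).Nonempty) = S
  have h1 := Finset.card_union_add_card_inter P Q
  have h2 := Finset.card_union_add_card_inter (P ∪ Q) S
  have h3 := Finset.card_union_add_card_inter P S
  have h4 := Finset.card_union_add_card_inter Q S
  have h5 := Finset.card_union_le (P ∩ S) (Q ∩ S)
  rw [← Finset.union_inter_distrib_right] at h5
  have h6 : (P ∪ Q).card + (P ∪ S).card + (Q ∪ S).card ≤
      P.card + Q.card + S.card + (P ∪ Q ∪ S).card := by
    have h7 := Finset.card_union_add_card_inter (P ∩ S) (Q ∩ S)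
    have h8 : ((P ∩ S) ∩ (Q ∩ S)).card ≤ (P ∩ Q).card := Finset.card_le_card fun x hx => by
      simp only [Finset.mem_inter] at hx ⊢
      exact ⟨hx.1.1, hx.2.1⟩
    rw [← Finset.union_inter_distrib_right] at h7
    omega
  exact_mod_cast h6

end Matroid

/-! ### A matroid with prescribed lattice of cyclic flats and prescribed ranks. -/

namespace LatticeMatroid

variable {L : Type u} [Lattice L] {n : ℕ}

/-- The subset of `L × Fin n` that represents the lattice element `x`. -/
def block (n : ℕ) (x : L) : Set (L × Fin n) := {v | v.1 ≤ x}

theorem block_inter (x y : L) : block n x ∩ block n y = block n (x ⊓ y) := by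
  ext v
  simp [block]

theorem block_union_subset (x y : L) : block n x ∪ block n y ⊆ block n (x ⊔ y) := by
  rintro v (h | h)
  · exact le_sup_of_le_left h
  · exact le_sup_of_le_right h

/-- A set is independent if it meets each block in at most the prescribed number of elements. -/
def Indep (r : L → ℕ) (I : Set (L × Fin n)) : Prop := ∀ x, (I ∩ block n x).ncard ≤ r x

theorem exists_tight_of_not_indep_insert {r : L → ℕ} {I : Set (L × Fin n)} (hI : Indep r I)
    {f : L × Fin n} (hf : ¬ Indep r (insert f I)) :
    ∃ x, (I ∩ block n x).ncard = r x ∧ f ∈ block n x := by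
  simp only [Indep, not_forall, not_le] at hf
  obtain ⟨x, hx⟩ := hf
  have hfx : f ∈ block n x := by
    by_contra h
    rw [insert_inter_of_notMem h] at hx
    exact absurd (hI x) (by omega)
  refine ⟨x, le_antisymm (hI x) ?_, hfx⟩
  rw [insert_inter_of_mem hfx] at hx
  have := ncard_insert_le f (I ∩ block n x)
  omega

variable [Fintype L]

theorem Indep.subset {r : L → ℕ} {I J : Set (L × Fin n)} (hJ : Indep r J) (hIJ : I ⊆ J) :
    Indep r I := fun x =>
  (ncard_le_ncard (inter_subset_inter_left _ hIJ) (toFinite _)).trans (hJ x)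

variable [BoundedOrder L]

/-- The properties of a function on a lattice that make it the rank function of a matroid whose
cyclic flats are the blocks. -/
structure IsRank (r : L → ℕ) : Prop where
  strictMono : StrictMono r
  map_bot : r ⊥ = 0
  submodular : ∀ x y, r (x ⊔ y) + r (x ⊓ y) ≤ r x + r y

/-- Submodularity makes the elements with tight blocks closed under joins, and `⊥` is tight since `r
⊥ = 0`. Their join is therefore tight, and its block contains every element that cannot be added to
`I`. -/
theorem exists_tight {r : L → ℕ} (hr : IsRank r) {I : Set (L × Fin n)} (hI : Indep r I) :
    ∃ z, (I ∩ block n z).ncard = r z ∧ ∀ f, ¬ Indep r (insert f I) → f ∈ block n z := by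
  classical
  refine ⟨(Finset.univ.filter fun x => (I ∩ block n x).ncard = r x).sup id, ?_, fun f hf => ?_⟩
  · refine Finset.sup_induction (p := fun z => (I ∩ block n z).ncard = r z) ?_ ?_ ?_
    · have := hI ⊥
      rw [hr.map_bot] at this ⊢
      omega
    · intro x hx y hy
      refine le_antisymm (hI _) ?_
      have h1 := ncard_union_add_ncard_inter (I ∩ block n x) (I ∩ block n y)
        (toFinite _) (toFinite _)
      rw [← inter_union_distrib_left, ← inter_inter_distrib_left, block_inter] at h1
      have h2 := ncard_le_ncard (inter_subset_inter_right I (block_union_subset (n := n) x y))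
        (toFinite _)
      have h3 := hI (x ⊓ y)
      have h4 := hr.submodular x y
      omega
    · simp
  · obtain ⟨x, hx, hfx⟩ := exists_tight_of_not_indep_insert hI hf
    exact le_trans hfx (Finset.le_sup (f := id) (by simpa using hx))

/-- The matroid on `L × Fin n` with independent sets given by `Indep r`. -/
def matroid (n : ℕ) {r : L → ℕ} (hr : IsRank r) : Matroid (L × Fin n) :=
  (IndepMatroid.ofFinite (E := univ) finite_univ (Indep r)
    (fun x => by simp) (fun _ _ hJ hIJ => hJ.subset hIJ)
    (fun I J hI hJ hlt => by
      by_contra! hcon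
      -- If nothing in `J` augments `I`, then `J` has no more elements than `I` outside the block of
      -- `z`, and none more inside it, where `I` is tight.
      obtain ⟨z, hz, hz'⟩ := exists_tight hr hI
      have hsub : J \ block n z ⊆ I \ block n z := fun e he =>
        ⟨by_contra fun heI => he.2 (hz' e (hcon e he.1 heI)), he.2⟩
      have h1 := ncard_le_ncard hsub (toFinite _)
      have h2 := ncard_inter_add_ncard_sdiff_eq_ncard J (block n z) (toFinite _)
      have h3 := ncard_inter_add_ncard_sdiff_eq_ncard I (block n z) (toFinite _)
      have h4 := hJ z
      omega)
    (fun _ _ => subset_univ _)).matroid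

variable {r : L → ℕ} (hr : IsRank r)

@[simp] theorem matroid_ground : (matroid n hr).E = univ := rfl

@[simp] theorem matroid_indep {I : Set (L × Fin n)} : (matroid n hr).Indep I ↔ Indep r I := Iff.rfl

theorem mem_closure_iff {I : Set (L × Fin n)} (hI : Indep r I) (f : L × Fin n) :
    f ∈ (matroid n hr).closure I ↔ (Indep r (insert f I) → f ∈ I) := by
  rw [((matroid_indep hr).2 hI).mem_closure_iff', matroid_ground, matroid_indep]
  simp

theorem block_subset_closure {I : Set (L × Fin n)} (hI : Indep r I) {x : L}
    (hx : (I ∩ block n x).ncard = r x) : block n x ⊆ (matroid n hr).closure I := by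
  intro f hf
  rw [mem_closure_iff hr hI]
  intro h
  by_contra hfI
  have := h x
  rw [insert_inter_of_mem hf, ncard_insert_of_notMem (fun h => hfI h.1) (toFinite _)] at this
  omega

/-- Any given element is avoided by some independent set of full size with first coordinate `x`. -/
theorem exists_indep_block {r : L → ℕ} (hr : IsRank r) (hn : r ⊤ < n) (x : L) (e : L × Fin n) :
    ∃ I, (∀ v ∈ I, v.1 = x) ∧ e ∉ I ∧ I.ncard = r x ∧ Indep r I := by
  -- Because `r ⊤ < n`, each fibre still has `r x` elements after one is dropped; this spare element
  -- makes blocks coloop-free.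
  have h1 : r x ≤ ({i : Fin n | i ≠ e.2}).ncard := by
    have h2 : ({i : Fin n | i ≠ e.2}).ncard = n - 1 := by
      have : {i : Fin n | i ≠ e.2} = {e.2}ᶜ := rfl
      rw [this, ncard_compl]
      simp
    have := hr.strictMono.monotone (le_top (a := x))
    omega
  obtain ⟨K, hK, hKc⟩ := exists_subset_card_eq h1
  refine ⟨(Prod.mk x) '' K, ?_, ?_, ?_, fun y => ?_⟩
  · rintro _ ⟨i, -, rfl⟩
    rfl
  · rintro ⟨i, hi, rfl⟩
    exact hK hi rfl
  · rw [ncard_image_of_injective _ (Prod.mk_right_injective x), hKc]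
  · by_cases hxy : x ≤ y
    · refine (ncard_le_ncard inter_subset_left (toFinite _)).trans ?_
      rw [ncard_image_of_injective _ (Prod.mk_right_injective x), hKc]
      exact hr.strictMono.monotone hxy
    · have : (Prod.mk x) '' K ∩ block n y = ∅ := by
        rw [eq_empty_iff_forall_notMem]
        rintro _ ⟨⟨i, -, rfl⟩, h⟩
        exact hxy h
      simp [this]

/-- An element outside the block of `x` can be added to `I`: its constraint at `y > x` has room by
strict monotonicity, and at `y` not above `x` the set `I` misses the block while `r y` is positive.
-/
theorem block_spanned {I : Set (L × Fin n)} {x : L} (hIx : ∀ v ∈ I, v.1 = x)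
    (hI : Indep r I) (hc : I.ncard = r x) : I ⊆ block n x ∧
      (matroid n hr).closure I = block n x := by
  have hsub : I ⊆ block n x := fun v hv => (hIx v hv).le
  refine ⟨hsub, Subset.antisymm (fun f hf => ?_)
    (block_subset_closure hr hI (by rw [inter_eq_left.2 hsub, hc]))⟩
  by_contra hfx
  rw [mem_closure_iff hr hI] at hf
  refine hfx (hsub (hf fun y => ?_))
  by_cases hfy : f ∈ block n y
  · rw [insert_inter_of_mem hfy]
    refine (ncard_insert_le _ _).trans ?_
    by_cases hxy : x ≤ y
    · have h1 : (I ∩ block n y).ncard ≤ r x :=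
        hc ▸ ncard_le_ncard inter_subset_left (toFinite _)
      have h2 : x < y := lt_of_le_of_ne hxy fun h => hfx (h ▸ hfy)
      have := hr.strictMono h2
      omega
    · have h1 : I ∩ block n y = ∅ := by
        rw [eq_empty_iff_forall_notMem]
        rintro v ⟨hv, hvy⟩
        exact hxy (hIx v hv ▸ hvy)
      have h2 : ⊥ < y := bot_lt_iff_ne_bot.2 fun h => hfx (by
        subst h
        exact le_trans hfy bot_le)
      have := hr.strictMono h2
      rw [h1, ncard_empty]
      omega
  · rw [insert_inter_of_notMem hfy]
    exact hI y

theorem isCyclicFlat_block (hn : r ⊤ < n) (x : L) :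
    (matroid n hr).IsCyclicFlat (block n x) := by
  rw [Matroid.isCyclicFlat_iff]
  refine ⟨?_, fun e he => ?_⟩
  · obtain ⟨I, hIx, -, hc, hI⟩ := exists_indep_block hr hn x (⊥, ⟨0, by omega⟩)
    rw [← (block_spanned hr hIx hI hc).2]
    exact (matroid n hr).isFlat_closure I
  · obtain ⟨I, hIx, heI, hc, hI⟩ := exists_indep_block hr hn x e
    obtain ⟨hsub, hcl⟩ := block_spanned hr hIx hI hc
    rw [← hcl] at he
    exact (matroid n hr).closure_subset_closure (subset_sdiff_singleton hsub heI) he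

theorem eRk_block (hn : r ⊤ < n) (x : L) : (matroid n hr).eRk (block n x) = r x := by
  obtain ⟨I, hIx, -, hc, hI⟩ := exists_indep_block hr hn x (⊥, ⟨0, by omega⟩)
  rw [← (block_spanned hr hIx hI hc).2, Matroid.eRk_closure_eq,
    ((matroid_indep hr).2 hI).eRk_eq_encard, ← hc, (toFinite I).cast_ncard_eq]

/-- Let `z` be the tight element for a basis `I` of `X`. An element of `X` outside the block of `z`
lies in `I`, and removing it leaves that block tight, so it would be a coloop of `X`. -/
theorem exists_block_eq {X : Set (L × Fin n)} (hX : (matroid n hr).IsCyclicFlat X) :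
    ∃ x, block n x = X := by
  rw [Matroid.isCyclicFlat_iff] at hX
  obtain ⟨I, hIX⟩ := (matroid n hr).exists_isBasis X (subset_univ _)
  have hI : Indep r I := hIX.indep
  obtain ⟨z, hz, hz'⟩ := exists_tight hr hI
  have hcl : (matroid n hr).closure I = X := by rw [hIX.closure_eq_closure, hX.1.closure]
  have hXI : ∀ f ∈ X, f ∉ I → f ∈ block n z := fun f hf hfI => hz' f fun h => by
    rw [← hcl, mem_closure_iff hr hI] at hf
    exact hfI (hf h)
  refine ⟨z, Subset.antisymm (hcl ▸ block_subset_closure hr hI hz) fun e he => ?_⟩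
  by_contra hez
  have heI : e ∈ I := by_contra fun h => hez (hXI e he h)
  have hIe : (I \ {e}) ∩ block n z = I ∩ block n z := by
    ext v
    simp only [mem_inter_iff, mem_sdiff, mem_singleton_iff]
    refine ⟨fun h => ⟨h.1.1, h.2⟩, fun h => ⟨⟨h.1, ?_⟩, h.2⟩⟩
    rintro rfl
    exact hez h.2
  have hsub : X \ {e} ⊆ (matroid n hr).closure (I \ {e}) := by
    intro f hf
    by_cases hfI : f ∈ I
    · exact (matroid n hr).mem_closure_of_mem ⟨hfI, hf.2⟩ (subset_univ _)
    · exact block_subset_closure hr (hI.subset sdiff_subset) (by rw [hIe, hz]) (hXI f hf.1 hfI)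
  exact hIX.indep.notMem_closure_sdiff_of_mem heI
    ((matroid n hr).closure_subset_closure_of_subset_closure hsub (hX.2 e he))

/-- The cyclic flats of the matroid are the blocks. -/
noncomputable def orderIso (hn : r ⊤ < n) : L ≃o (matroid n hr).CyclicFlats :=
  RelIso.ofSurjective
    (OrderEmbedding.ofMapLEIff
      (fun x => (⟨block n x, isCyclicFlat_block hr hn x⟩ : (matroid n hr).CyclicFlats))
      fun x y => ⟨fun h => h (show ((x, ⟨0, by omega⟩) : L × Fin n) ∈ block n x from le_refl x),
        fun h _ hv => le_trans hv h⟩)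
    fun X => (exists_block_eq hr X.2).imp fun _ hx => Subtype.ext hx

theorem eRk_block_union (hn : r ⊤ < n) (x y : L) :
    (matroid n hr).eRk (block n x ∪ block n y) = r (x ⊔ y) := by
  have h : block n (x ⊔ y) = (matroid n hr).closure (block n x ∪ block n y) :=
    congrArg Subtype.val ((orderIso hr hn).map_sup x y)
  rw [← Matroid.eRk_closure_eq, ← h, eRk_block hr hn]

theorem rank_le_of_isTransversal (hn : r ⊤ < n) (hT : (matroid n hr).IsTransversal) (p q s : L) :
    r (p ⊔ q) + r (p ⊔ s) + r (q ⊔ s) ≤ r p + r q + r s + r (p ⊔ q ⊔ s) := by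
  have : (matroid n hr).Finite := ⟨finite_univ⟩
  have hc := fun x => ((Matroid.isCyclicFlat_iff _ _).1 (isCyclicFlat_block hr hn x)).2
  have h := hT.eRk_union_le (hc p) (hc q) (hc s)
  have h' : (matroid n hr).eRk (block n p ∪ block n q ∪ block n s) = r (p ⊔ q ⊔ s) := by
    rw [← Matroid.eRk_union_closure_left_eq, ← eRk_block_union hr hn]
    congr 2
    exact (congrArg Subtype.val ((orderIso hr hn).map_sup p q)).symm
  rw [h', eRk_block_union hr hn, eRk_block_union hr hn, eRk_block_union hr hn, eRk_block hr hn,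
    eRk_block hr hn, eRk_block hr hn] at h
  exact_mod_cast h

end LatticeMatroid

/-! ### The three-element condition in Tr-lattices. -/

section TrLattice

variable {L : Type u} [Lattice L]

open scoped Classical in
/-- The number of elements of `V` that are not upper bounds of `x`. -/
noncomputable def notAboveCard (V : Finset L) (x : L) : ℕ := (V.filter fun v => ¬ x ≤ v).card

theorem notAboveCard_mono (V : Finset L) : Monotone (notAboveCard V) := fun _ _ h =>
  Finset.card_le_card fun v => by
    simp only [Finset.mem_filter]
    exact fun hv => ⟨hv.1, fun h' => hv.2 (h.trans h')⟩

theorem notAboveCard_submodular (V : Finset L) (x y : L) :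
    notAboveCard V (x ⊔ y) + notAboveCard V (x ⊓ y) ≤ notAboveCard V x + notAboveCard V y := by
  classical
  unfold notAboveCard
  rw [← Finset.card_union_add_card_inter (V.filter fun v => ¬ x ≤ v)]
  refine add_le_add (Finset.card_le_card ?_) (Finset.card_le_card ?_)
  · intro v
    simp only [Finset.mem_filter, Finset.mem_union, sup_le_iff]
    tauto
  · intro v
    simp only [Finset.mem_filter, Finset.mem_inter]
    exact fun h => ⟨⟨h.1, fun h' => h.2 (inf_le_of_left_le h')⟩,
      ⟨h.1, fun h' => h.2 (inf_le_of_right_le h')⟩⟩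

theorem notAboveCard_univ_strictMono [Fintype L] :
    StrictMono (notAboveCard (Finset.univ : Finset L)) := fun x y h =>
  Finset.card_lt_card (Finset.ssubset_iff_of_subset (fun v => by
    simp only [Finset.mem_filter]
    exact fun hv => ⟨hv.1, fun h' => hv.2 (h.le.trans h')⟩) |>.2
      ⟨x, by simpa using h.not_ge, by simp⟩)

/-- Truncating a monotone submodular function at a constant keeps it submodular. The first summand
supplies strictness, and a large `k` lets the second dominate. -/
theorem isRank_notAboveCard_add [Fintype L] [BoundedOrder L] (V : Finset L) (k c : ℕ) :
    LatticeMatroid.IsRank fun x =>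
      notAboveCard (Finset.univ : Finset L) x + k * min c (notAboveCard V x) where
  strictMono := notAboveCard_univ_strictMono.add_monotone fun x y h =>
    Nat.mul_le_mul_left k (min_le_min_left c (notAboveCard_mono V h))
  map_bot := by simp [notAboveCard]
  submodular x y := by
    have h1 := notAboveCard_submodular Finset.univ x y
    have h2 := notAboveCard_submodular V x y
    have h3 := notAboveCard_mono V (le_sup_left (a := x) (b := y))
    have h4 := notAboveCard_mono V (le_sup_right (a := x) (b := y))
    have h5 := notAboveCard_mono V (inf_le_left (a := x) (b := y))
    have h6 := notAboveCard_mono V (inf_le_right (a := x) (b := y))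
    have h7 : min c (notAboveCard V (x ⊔ y)) + min c (notAboveCard V (x ⊓ y)) ≤
      min c (notAboveCard V x) + min c (notAboveCard V y) := by omega
    have h8 := Nat.mul_le_mul_left k h7
    rw [mul_add, mul_add] at h8
    omega

/-- In a Tr-lattice, of any three elements one lies below the join of the other two. -/
theorem IsTrLattice.le_sup_of_three (hL : IsTrLattice L) (p q s : L) :
    p ≤ q ⊔ s ∨ q ≤ p ⊔ s ∨ s ≤ p ⊔ q := by
  classical
  by_contra! ⟨hp, hq, hs⟩
  obtain ⟨hfin, hL⟩ := hL
  have := Fintype.ofFinite L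
  have : Nonempty L := ⟨p⟩
  let := Fintype.toBoundedOrder L
  have hab : q ⊔ s ≠ p ⊔ s := fun h => hp (h ▸ le_sup_left)
  have hac : q ⊔ s ≠ p ⊔ q := fun h => hp (h ▸ le_sup_left)
  have hbc : p ⊔ s ≠ p ⊔ q := fun h => hq (h ▸ le_sup_right)
  -- Each of `p`, `q`, `s` fails to lie below at most one member of `V`, while each pairwise join
  -- fails for at least two.
  set V : Finset L := {q ⊔ s, p ⊔ s, p ⊔ q} with hV
  have one : ∀ x a, (∀ v ∈ V, v ≠ a → x ≤ v) → notAboveCard V x ≤ 1 := by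
    intro x a h
    rw [← Finset.card_singleton a]
    refine Finset.card_le_card fun v hv => Finset.mem_singleton.2 ?_
    by_contra hva
    exact (Finset.mem_filter.1 hv).2 (h v (Finset.mem_filter.1 hv).1 hva)
  have hone_p := one p (q ⊔ s) fun v hvV hv => by
    simp only [hV, Finset.mem_insert, Finset.mem_singleton] at hvV
    rcases hvV with rfl | rfl | rfl
    · exact absurd rfl hv
    · exact le_sup_left
    · exact le_sup_left
  have hone_q := one q (p ⊔ s) fun v hvV hv => by
    simp only [hV, Finset.mem_insert, Finset.mem_singleton] at hvV
    rcases hvV with rfl | rfl | rfl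
    · exact le_sup_left
    · exact absurd rfl hv
    · exact le_sup_right
  have hone_s := one s (p ⊔ q) fun v hvV hv => by
    simp only [hV, Finset.mem_insert, Finset.mem_singleton] at hvV
    rcases hvV with rfl | rfl | rfl
    · exact le_sup_right
    · exact le_sup_right
    · exact absurd rfl hv
  have two : ∀ x a b, a ∈ V → b ∈ V → a ≠ b → ¬ x ≤ a → ¬ x ≤ b → 2 ≤ notAboveCard V x := by
    intro x a b ha hb hne hxa hxb
    rw [← Finset.card_pair hne]
    refine Finset.card_le_card fun v hv => ?_
    rcases Finset.mem_insert.1 hv with rfl | hv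
    · exact Finset.mem_filter.2 ⟨ha, hxa⟩
    · rw [Finset.mem_singleton.1 hv]
      exact Finset.mem_filter.2 ⟨hb, hxb⟩
  -- With weight `k`, the truncated terms give `6 * k` on the left of the inequality and at most `5
  -- * k` on the right. The other summand can compensate by at most `Fintype.card L`, hence `k =
  -- Fintype.card L + 1`.
  have hr := isRank_notAboveCard_add V (Fintype.card L + 1) 2
  have hT := hL _ (LatticeMatroid.matroid _ hr) ⟨finite_univ⟩
    ⟨(LatticeMatroid.orderIso hr (Nat.lt_succ_self _)).symm⟩
  have h := LatticeMatroid.rank_le_of_isTransversal hr (Nat.lt_succ_self _) hT p q s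
  have hpq := two (p ⊔ q) _ _ (by simp [hV]) (by simp [hV]) hab
    (fun h => hp (le_sup_left.trans h)) fun h => hq (le_sup_right.trans h)
  have hps := two (p ⊔ s) _ _ (by simp [hV]) (by simp [hV]) hac
    (fun h => hp (le_sup_left.trans h)) fun h => hs (le_sup_right.trans h)
  have hqs := two (q ⊔ s) _ _ (by simp [hV]) (by simp [hV]) hbc
    (fun h => hq (le_sup_left.trans h)) fun h => hs (le_sup_right.trans h)
  have hp1 := Nat.mul_le_mul_left (Fintype.card L + 1) ((min_le_right 2 _).trans hone_p)
  have hq1 := Nat.mul_le_mul_left (Fintype.card L + 1) ((min_le_right 2 _).trans hone_q)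
  have hs1 := Nat.mul_le_mul_left (Fintype.card L + 1) ((min_le_right 2 _).trans hone_s)
  have ht := Nat.mul_le_mul_left (Fintype.card L + 1)
    (min_le_left 2 (notAboveCard V (p ⊔ q ⊔ s)))
  rw [min_eq_left hpq, min_eq_left hps, min_eq_left hqs] at h
  have m1 := notAboveCard_mono (Finset.univ : Finset L) (le_sup_left (a := p) (b := q))
  have m2 := notAboveCard_mono (Finset.univ : Finset L) (le_sup_left (a := q) (b := s))
  have m3 := notAboveCard_mono (Finset.univ : Finset L) (le_sup_right (a := p) (b := s))
  have m4 : notAboveCard (Finset.univ : Finset L) (p ⊔ q ⊔ s) ≤ Fintype.card L :=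
    Finset.card_filter_le _ _
  omega

end TrLattice

/-! ### Circuits, separators and nestedness. -/

namespace Matroid

variable {α : Type u} {M : Matroid α}

/-- Lying in a common circuit is transitive: a circuit through `e` and a circuit through `f` that
meet can be replaced by a single circuit through `e` and `f`. -/
theorem exists_isCircuit_of_inter_nonempty [M.Finite] {e f : α} {C D : Set α} (hC : M.IsCircuit C)
    (hD : M.IsCircuit D) (heC : e ∈ C) (hfD : f ∈ D) (hCD : (C ∩ D).Nonempty) :
    ∃ K, M.IsCircuit K ∧ e ∈ K ∧ f ∈ K := by
  induction hk : (C ∪ D).ncard using Nat.strong_induction_on generalizing C D with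
  | _ k ih =>
  subst hk
  have hfin : (C ∪ D).Finite :=
    M.ground_finite.subset (union_subset hC.subset_ground hD.subset_ground)
  by_cases hfC : f ∈ C
  · exact ⟨C, hC, heC, hfC⟩
  by_cases heD : e ∈ D
  · exact ⟨D, hD, heD, hfD⟩
  obtain ⟨x, hxC, hxD⟩ := hCD
  obtain ⟨C', hC's, hC', heC'⟩ := hC.strong_elimination hD hxC hxD heC heD
  obtain ⟨D', hD's, hD', hfD'⟩ := hD.strong_elimination hC hxD hxC hfD hfC
  rw [union_comm] at hD's
  have hC'D : (C' ∩ D).Nonempty := by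
    by_contra hemp
    rw [not_nonempty_iff_eq_empty] at hemp
    have hsub : C' ⊆ C := fun y hy => (hC's hy).1.elim id fun h =>
      absurd (show y ∈ C' ∩ D from ⟨hy, h⟩) (by simp [hemp])
    exact (hC's ((hC'.eq_of_subset_isCircuit hC hsub) ▸ hxC)).2 rfl
  have hD'C : (D' ∩ (C \ D)).Nonempty := by
    by_contra hemp
    rw [not_nonempty_iff_eq_empty] at hemp
    have hsub : D' ⊆ D := fun y hy => by_contra fun h =>
      absurd (show y ∈ D' ∩ (C \ D) from ⟨hy, (hD's hy).1.resolve_right h, h⟩) (by simp [hemp])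
    exact (hD's ((hD'.eq_of_subset_isCircuit hD hsub) ▸ hxD)).2 rfl
  have hsub1 : C' ∪ D ⊆ C ∪ D := union_subset (hC's.trans sdiff_subset) subset_union_right
  -- Either `C'` and `D` have a smaller union, or `C'` contains `C \ D` and so meets `D'`; in that
  -- case `C' ∪ D'` is smaller because it omits `x`.
  by_cases heq : C' ∪ D = C ∪ D
  · obtain ⟨y, hyD', hyC, hyD⟩ := hD'C
    have hyC' : y ∈ C' := by
      have : y ∈ C' ∪ D := heq ▸ Or.inl hyC
      exact this.resolve_right hyD
    refine ih _ (ncard_lt_ncard ⟨?_, fun h => ?_⟩ hfin) hC' hD' heC' hfD' ⟨y, hyC', hyD'⟩ rfl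
    · exact (union_subset hC's hD's).trans sdiff_subset
    · exact ((union_subset hC's hD's) (h (Or.inl hxC))).2 rfl
  · exact ih _ (ncard_lt_ncard (hsub1.ssubset_of_ne heq) hfin) hC' hD heC' hfD hC'D rfl

/-- A matroid that is not connected has a separator that is neither empty nor the ground set. -/
theorem exists_separator_of_not_isConnected [M.Finite] (hM : ¬ M.IsConnected) :
    ∃ A, (M.E ∩ A).Nonempty ∧ (M.E \ A).Nonempty ∧
      ∀ C, M.IsCircuit C → C ⊆ A ∨ Disjoint C A := by
  simp only [IsConnected, not_forall, exists_prop] at hM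
  obtain ⟨e, he, f, hf, hne, hef⟩ := hM
  refine ⟨{x | x = e ∨ ∃ C, M.IsCircuit C ∧ e ∈ C ∧ x ∈ C}, ⟨e, he, Or.inl rfl⟩, ⟨f, hf, ?_⟩, ?_⟩
  · rintro (h | h)
    · exact hne h.symm
    · exact hef h
  · intro C hC
    rw [or_iff_not_imp_right, not_disjoint_iff]
    rintro ⟨x, hxC, hx⟩ y hyC
    obtain rfl | ⟨D, hD, heD, hxD⟩ := hx
    · exact Or.inr ⟨C, hC, hxC, hyC⟩
    · exact Or.inr (exists_isCircuit_of_inter_nonempty hD hC heD hyC ⟨x, hxD, hxC⟩)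

/-- A separator and its complement decompose the matroid as a direct sum. -/
theorem eq_disjointSigma_of_separator {A : Set α}
    (hA : ∀ C, M.IsCircuit C → C ⊆ A ∨ Disjoint C A)
    (h : Pairwise (Disjoint on fun i => ((![M ↾ (M.E ∩ A), M ↾ (M.E \ A)] : Fin 2 → _) i).E)) :
    M = Matroid.disjointSigma ![M ↾ (M.E ∩ A), M ↾ (M.E \ A)] h := by
  have hE : (⋃ i, ((![M ↾ (M.E ∩ A), M ↾ (M.E \ A)] : Fin 2 → _) i).E) = M.E := by
    ext x
    simp only [mem_iUnion, Fin.exists_fin_two]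
    simp only [Matrix.cons_val_zero, Matrix.cons_val_one, restrict_ground_eq, mem_inter_iff,
      mem_sdiff]
    tauto
  refine ext_indep (by rw [disjointSigma_ground_eq, hE]) fun I hI => ?_
  rw [disjointSigma_indep_iff, hE, and_iff_left hI, Fin.forall_fin_two]
  simp only [Matrix.cons_val_zero, Matrix.cons_val_one, restrict_ground_eq, restrict_indep_iff,
    inter_subset_right, and_true]
  refine ⟨fun h => ⟨h.inter_right _, h.inter_right _⟩, fun ⟨h1, h2⟩ => ?_⟩
  rw [indep_iff_forall_subset_not_isCircuit hI]
  intro C hCI hC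
  obtain hCA | hCA := hA C hC
  · exact hC.not_indep (h1.subset (subset_inter hCI (subset_inter hC.subset_ground hCA)))
  · exact hC.not_indep (h2.subset (subset_inter hCI (subset_sdiff.2 ⟨hC.subset_ground, hCA⟩)))

theorem isCyclicFlat_closure {X : Set α} (hX : ∀ e ∈ X, e ∈ M.closure (X \ {e})) :
    M.IsCyclicFlat (M.closure X) := by
  have hXE : X ⊆ M.E := fun e he => M.closure_subset_ground _ (hX e he)
  have hsub := M.subset_closure X hXE
  refine (isCyclicFlat_iff _ _).2 ⟨M.isFlat_closure X, fun e he => ?_⟩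
  by_cases heX : e ∈ X
  · exact M.closure_subset_closure (sdiff_subset_sdiff_left hsub) (hX e heX)
  · exact M.closure_subset_closure (subset_sdiff_singleton hsub heX) he

/-- The cyclic flat spanned by a coloop-free set. -/
def CyclicFlats.ofClosure {X : Set α} (hX : ∀ e ∈ X, e ∈ M.closure (X \ {e})) : M.CyclicFlats :=
  ⟨M.closure X, isCyclicFlat_closure hX⟩

/-- If `Z(M)` is a Tr-lattice, then of any three coloop-free sets one is spanned by the other two. -/
theorem subset_closure_union_of_isTrLattice (hM : IsTrLattice M.CyclicFlats) {X Y Z : Set α}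
    (hX : ∀ e ∈ X, e ∈ M.closure (X \ {e})) (hY : ∀ e ∈ Y, e ∈ M.closure (Y \ {e}))
    (hZ : ∀ e ∈ Z, e ∈ M.closure (Z \ {e})) :
    X ⊆ M.closure (Y ∪ Z) ∨ Y ⊆ M.closure (X ∪ Z) ∨ Z ⊆ M.closure (X ∪ Y) := by
  have key : ∀ {U V W : Set α} (hU : ∀ e ∈ U, e ∈ M.closure (U \ {e}))
      (hV : ∀ e ∈ V, e ∈ M.closure (V \ {e})) (hW : ∀ e ∈ W, e ∈ M.closure (W \ {e})),
      CyclicFlats.ofClosure hU ≤ CyclicFlats.ofClosure hV ⊔ CyclicFlats.ofClosure hW →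
      U ⊆ M.closure (V ∪ W) := by
    intro U V W hU hV hW h
    have h' : M.closure U ⊆ M.closure (M.closure V ∪ M.closure W) := h
    rw [closure_union_closure_left_eq, closure_union_closure_right_eq] at h'
    exact (M.subset_closure U fun e he => M.closure_subset_ground _ (hU e he)).trans h'
  exact (hM.le_sup_of_three _ _ _).imp (key hX hY hZ) (Or.imp (key hY hX hZ) (key hZ hX hY))

/-- Let `M` be loopless and such that of any three coloop-free sets one is spanned by the other two.
If some element that is not a coloop lies outside a separator `A`, then the restriction of `M` to
`A` is nested. -/
theorem isNested_of_separator (hM : ∀ X Y Z : Set α, (∀ e ∈ X, e ∈ M.closure (X \ {e})) →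
      (∀ e ∈ Y, e ∈ M.closure (Y \ {e})) → (∀ e ∈ Z, e ∈ M.closure (Z \ {e})) →
      X ⊆ M.closure (Y ∪ Z) ∨ Y ⊆ M.closure (X ∪ Z) ∨ Z ⊆ M.closure (X ∪ Y))
    {A R : Set α} (hA : ∀ C, M.IsCircuit C → C ⊆ A ∨ Disjoint C A) (hRA : R ⊆ A) (hRE : R ⊆ M.E)
    {f : α} (hfA : f ∉ A) (hfl : ¬ M.IsLoop f) {D : Set α} (hD : M.IsCircuit D) (hfD : f ∈ D) :
    (M ↾ R).IsNested := by
  have hDA : Disjoint D A := (hA D hD).resolve_left fun h => hfA (h hfD)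
  have hcyc : ∀ X : (M ↾ R).CyclicFlats, X.1 ⊆ R ∧ ∀ e ∈ X.1, e ∈ M.closure (X.1 \ {e}) := by
    intro X
    have hX := (isCyclicFlat_iff _ _).1 X.2
    have hXR : X.1 ⊆ R := hX.1.subset_ground
    refine ⟨hXR, fun e he => ?_⟩
    have := hX.2 e he
    rw [restrict_closure_eq _ (sdiff_subset.trans hXR) hRE] at this
    exact this.1
  -- A circuit through an element of `R` stays in `A`, which is disjoint from `D`, so `D`
  -- contributes nothing to the span.
  have hsub : ∀ X Y : (M ↾ R).CyclicFlats, X.1 ⊆ M.closure (Y.1 ∪ D) → X ≤ Y := by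
    intro X Y h x hx
    by_contra hxY
    have hxR := (hcyc X).1 hx
    have hxD : x ∉ D := fun h' => hDA.notMem_of_mem_left h' (hRA hxR)
    obtain ⟨C, hCs, hC, hxC⟩ :=
      (mem_closure_iff_exists_isCircuit (fun h' => h'.elim hxY hxD)).1 (h hx)
    have hCA : C ⊆ A := (hA C hC).resolve_right fun h' => h'.notMem_of_mem_left hxC (hRA hxR)
    have hxcl : x ∈ M.closure Y.1 := (mem_closure_iff_exists_isCircuit hxY).2 ⟨C, fun y hy =>
      (hCs hy).imp id fun h' => h'.resolve_right fun h'' =>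
        hDA.notMem_of_mem_left h'' (hCA hy), hC, hxC⟩
    have hfl : (M ↾ R).closure Y.1 = Y.1 := Y.2.isFlat.closure
    rw [restrict_closure_eq _ (hcyc Y).1 hRE] at hfl
    exact hxY (hfl ▸ ⟨hxcl, hxR⟩)
  intro X Y
  obtain h | h | h := hM X.1 Y.1 D (hcyc X).2 (hcyc Y).2
    fun e he => hD.mem_closure_sdiff_singleton_of_mem he
  · exact Or.inl (hsub X Y h)
  · exact Or.inr (hsub Y X h)
  -- A circuit showing that `f` is spanned by a subset of `A` avoids `A`, so it is `{f}`, but `f` is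
  -- not a loop.
  · have hXYA : X.1 ∪ Y.1 ⊆ A := (union_subset (hcyc X).1 (hcyc Y).1).trans hRA
    obtain ⟨C, hCs, hC, hfC⟩ :=
      (mem_closure_iff_exists_isCircuit (fun h' => hfA (hXYA h'))).1 (h hfD)
    have hCA : Disjoint C A := (hA C hC).resolve_left fun h' => hfA (h' hfC)
    have : C = {f} := Subset.antisymm (fun y hy => (hCs hy).elim id fun h' =>
      absurd (hXYA h') (hCA.notMem_of_mem_left hy)) (singleton_subset_iff.2 hfC)
    exact absurd (singleton_isCircuit.1 (this ▸ hC)) hfl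

theorem delete_loops_union_coloops_not_isLoop {e : α} :
    ¬ (M.delete (M.loops ∪ M.coloops)).IsLoop e := by
  rw [delete_isLoop_iff]
  exact fun h => h.2 (Or.inl h.1)

theorem exists_isCircuit_delete_loops_union_coloops {e : α}
    (he : e ∈ (M.delete (M.loops ∪ M.coloops)).E) :
    ∃ C, (M.delete (M.loops ∪ M.coloops)).IsCircuit C ∧ e ∈ C := by
  rw [delete_ground, mem_sdiff, mem_union, not_or] at he
  obtain ⟨C, hC, heC⟩ := exists_mem_isCircuit_of_not_isColoop he.1 he.2.2
  refine ⟨C, delete_isCircuit_iff.2 ⟨hC, disjoint_union_right.2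
    ⟨disjoint_left.2 fun x hxC hx => ?_, hC.disjoint_coloops⟩⟩, heC⟩
  have := (singleton_isCircuit.2 hx).eq_of_subset_isCircuit hC (singleton_subset_iff.2 hxC)
  rw [← this, mem_singleton_iff] at heC
  exact he.2.1 (heC ▸ hx)

theorem mem_closure_of_mem_delete_closure {D X : Set α} {e : α}
    (h : e ∈ (M.delete D).closure X) : e ∈ M.closure X := by
  rw [delete_closure_eq] at h
  exact M.closure_subset_closure sdiff_subset h.1

theorem subset_delete_closure {D X U : Set α} (hX : X ⊆ (M.delete D).E)
    (hU : U ⊆ (M.delete D).E) (h : X ⊆ M.closure U) : X ⊆ (M.delete D).closure U := by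
  rw [delete_closure_eq, sdiff_eq_left.2 (subset_sdiff.1 hU).2]
  exact subset_sdiff.2 ⟨h, (subset_sdiff.1 hX).2⟩

end Matroid

theorem mainTheorem8 {α : Type u} (M : Matroid α) [M.Finite] (hM : IsTrLattice M.CyclicFlats) :
    (M.delete (M.loops ∪ M.coloops)).IsConnected ∨
      ∃ (k : ℕ) (N : Fin k → Matroid α) (hN : Pairwise (Disjoint on fun i => (N i).E)),
        k ≤ 2 ∧ (∀ i, (N i).IsNested) ∧
          M.delete (M.loops ∪ M.coloops) = Matroid.disjointSigma N hN := by
  rw [or_iff_not_imp_left]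
  intro hcon
  set N := M.delete (M.loops ∪ M.coloops)
  obtain ⟨A, ⟨e, heE, heA⟩, ⟨f, hfE, hfA⟩, hA⟩ := Matroid.exists_separator_of_not_isConnected hcon
  -- Stated for coloop-free sets rather than cyclic flats, the condition passes from `M` to `N`
  -- without comparing their lattices.
  have hthree : ∀ X Y Z : Set α, (∀ e ∈ X, e ∈ N.closure (X \ {e})) →
      (∀ e ∈ Y, e ∈ N.closure (Y \ {e})) → (∀ e ∈ Z, e ∈ N.closure (Z \ {e})) →
      X ⊆ N.closure (Y ∪ Z) ∨ Y ⊆ N.closure (X ∪ Z) ∨ Z ⊆ N.closure (X ∪ Y) := by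
    intro X Y Z hX hY hZ
    have hXE : X ⊆ N.E := fun e he => N.closure_subset_ground _ (hX e he)
    have hYE : Y ⊆ N.E := fun e he => N.closure_subset_ground _ (hY e he)
    have hZE : Z ⊆ N.E := fun e he => N.closure_subset_ground _ (hZ e he)
    exact (Matroid.subset_closure_union_of_isTrLattice hM
      (fun e he => Matroid.mem_closure_of_mem_delete_closure (hX e he))
      (fun e he => Matroid.mem_closure_of_mem_delete_closure (hY e he))
      (fun e he => Matroid.mem_closure_of_mem_delete_closure (hZ e he))).imp
      (Matroid.subset_delete_closure hXE (union_subset hYE hZE)) (Or.imp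
        (Matroid.subset_delete_closure hYE (union_subset hXE hZE))
        (Matroid.subset_delete_closure hZE (union_subset hXE hYE)))
  obtain ⟨C, hC, heC⟩ := Matroid.exists_isCircuit_delete_loops_union_coloops heE
  obtain ⟨D, hD, hfD⟩ := Matroid.exists_isCircuit_delete_loops_union_coloops hfE
  have hA' : ∀ K, N.IsCircuit K → K ⊆ Aᶜ ∨ Disjoint K Aᶜ := fun K hK =>
    (hA K hK).symm.imp subset_compl_iff_disjoint_right.2 disjoint_compl_right_iff_subset.2
  have hdisj : Pairwise (Disjoint on
      fun i => ((![N.restrict (N.E ∩ A), N.restrict (N.E \ A)] : Fin 2 → _) i).E) := by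
    have h : Disjoint (N.E ∩ A) (N.E \ A) := disjoint_sdiff_inter.symm
    intro i j hij
    fin_cases i <;> fin_cases j
    · exact absurd rfl hij
    · exact h
    · exact h.symm
    · exact absurd rfl hij
  refine ⟨2, _, hdisj, le_rfl, Fin.forall_fin_two.2 ⟨?_, ?_⟩,
    Matroid.eq_disjointSigma_of_separator hA hdisj⟩
  · exact Matroid.isNested_of_separator hthree hA inter_subset_right inter_subset_left hfA
      Matroid.delete_loops_union_coloops_not_isLoop hD hfD
  · exact Matroid.isNested_of_separator hthree hA' (fun x hx => hx.2) sdiff_subset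
      (not_not.2 heA) Matroid.delete_loops_union_coloops_not_isLoop hC heC
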